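/- A mean-payoff bidding game $\mathcal G=\langle V,E,w\rangle$ consists of a finite directed graph $(V,E)$ in which every vertex has a successor, and weights $w:V\to\mathbb Z$. A token is placed on a vertex, and the players Min and Max have budgets in $[0,1]$ that sum up to $1$. In each round, based on the history (the vertices visited, the winning bids and the winners so far), both players simultaneously choose a bid in $[0,1]$ and a successor of the current vertex. The higher bidder pays his bid to the other player and moves the token to the successor that he chose; ties are resolved by an arbitrary fixed tie-breaking mechanism. A strategy is legal with respect to an initial budget if its bids never exceed the current budget of the player. The value of an infinite path $v_0,v_1,\dots$ is $\liminf_{n\to\infty}\frac1n\sum_{i<n}w(v_i)$. A player with initial budget $B$ (his opponent having $1-B$) can guarantee a property of the value from $v$ if he has a legal strategy such that, for every legal strategy of the opponent, the value of the outcome from $v$ has the property. A threshold budget at $v$ is a number $t\in[0,1]$ such that, from $v$, Min can guarantee a non-positive value with every budget $B\in[0,1]$ with $B>t$, and Max can guarantee a strictly positive value with every budget $B\in[0,1]$ with $B>1-t$. For $u\in V$, let $\mathcal G^u$ be obtained from $\mathcal G$ by splitting $u$ into a copy $u_s$ that keeps the outgoing edges and the weight of $u$ and has no incoming edges, and a copy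 $u_t$ that keeps the incoming edges and has no outgoing edges (a self-loop at $u$ becomes an edge from $u_s$ to $u_t$). A weighted Richman function with respect to $u$ is a function $W$ from the vertices of $\mathcal G^u$ to $\mathbb Q$ with $W(u_t)=0$ and $W(v)=\frac12\bigl(W(v^+)+W(v^-)\bigr)+w(v)$ for every $v\ne u_t$, where $v^+$ and $v^-$ are successors of $v$ in $\mathcal G^u$ with maximal and minimal value of $W$; then $W(u_s)$ is called a weighted Richman value of $u$. **Lemma.** Let $\mathcal G=\langle V,E,w\rangle$ be a strongly connected mean-payoff bidding game. For every $u\in V$ there is a weighted Richman function with respect to $u$. Moreover, there is $\tau\in\{0,1\}$ such that for every $v\in V$, $\tau$ is the unique threshold budget at $v$, and $\tau=0$ if and only if some vertex $u\in V$ has a weighted Richman value $W(u_s)\le 0$. -/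

import Mathlib

/-- The two players of a mean-payoff game. -/
inductive Player : Type
  | min
  | max
  deriving DecidableEq

/-- A mean-payoff bidding game `⟨V, E, w⟩`: a directed graph in which every vertex has a
successor (so that outcomes are infinite), with integer weights on the vertices. -/
structure MeanPayoffGame (V : Type*) where
  /-- The edge relation. -/
  E : V → V → Prop
  /-- The weight function. -/
  w : V → ℤ
  /-- The token can always be moved. -/
  serial : ∀ v, ∃ v', E v v'

/-- A history `v₀, ⟨v₁, b₁, i₁⟩, …, ⟨vₖ, bₖ, iₖ⟩`: in round `j` the winning bid is `bⱼ`, the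
winner is Player `iⱼ`, and the token is moved to `vⱼ`. -/
inductive History (V : Type*) : Type _
  | init (v₀ : V) : History V
  | step (h : History V) (v : V) (b : unitInterval) (i : Player) : History V

namespace History

variable {V : Type*}

/-- The vertex on which the token is placed at the end of a history. -/
def last : History V → V
  | init v₀ => v₀
  | step _ v _ _ => v

/-- The total payment of Player `p`: the bids that he won minus the bids that he lost. -/
noncomputable def payment (p : Player) : History V → ℝ
  | init _ => 0
  | step h _ b i => payment p h + if i = p then (b : ℝ) else -(b : ℝ)

end History

/-- An action `⟨b, v⟩`: a bid, and the vertex to move to upon winning. -/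
abbrev BidAction (V : Type*) := unitInterval × V

/-- A tie-breaking mechanism: it determines the winner of a round in which the two bids are equal,
from the history and the actions of Min and Max in the round. -/
abbrev TieBreaking (V : Type*) := History V → BidAction V → BidAction V → Player

namespace MeanPayoffGame

variable {V : Type*} (G : MeanPayoffGame V)

/-- Every vertex is reachable from every vertex. -/
def StronglyConnected : Prop := ∀ u v, Relation.ReflTransGen G.E u v

/-- A strategy maps each history to an action that moves the token along an edge. -/
structure Strategy where
  /-- The action that the strategy prescribes after a history. -/
  act : History V → BidAction V
  /-- The token is moved along edges. -/
  edge : ∀ h, G.E h.last (act h).2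

/-- One round of bidding: the higher bidder wins, and moves the token. -/
noncomputable def next (tie : TieBreaking V) (fm fM : G.Strategy) (h : History V) : History V :=
  open Classical in
  let winner : Player :=
    if (fM.act h).1 < (fm.act h).1 then Player.min
    else if (fm.act h).1 < (fM.act h).1 then Player.max
    else tie h (fm.act h) (fM.act h)
  match winner with
  | Player.min => h.step (fm.act h).2 (fm.act h).1 Player.min
  | Player.max => h.step (fM.act h).2 (fM.act h).1 Player.max

/-- The prefix after `n` rounds of the outcome of the strategies `fm` of Min and `fM` of Max from
the vertex `v₀`. -/
noncomputable def out (tie : TieBreaking V) (v₀ : V) (fm fM : G.Strategy) : ℕ → History V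
  | 0 => History.init v₀
  | n + 1 => G.next tie fm fM (out tie v₀ fm fM n)

/-- The strategy `fm` of Min is legal with respect to the initial budget `B`: his bids never surpass
his current budget. -/
def LegalMin (tie : TieBreaking V) (B : ℝ) (fm : G.Strategy) : Prop :=
  ∀ (v₀ : V) (fM : G.Strategy) (n : ℕ),
    ((fm.act (G.out tie v₀ fm fM n)).1 : ℝ) ≤ B - (G.out tie v₀ fm fM n).payment Player.min

/-- The strategy `fM` of Max is legal with respect to the initial budget `B`. -/
def LegalMax (tie : TieBreaking V) (B : ℝ) (fM : G.Strategy) : Prop :=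
  ∀ (v₀ : V) (fm : G.Strategy) (n : ℕ),
    ((fM.act (G.out tie v₀ fm fM n)).1 : ℝ) ≤ B - (G.out tie v₀ fm fM n).payment Player.max

/-- The energy of the first `n` vertices of an infinite path: the sum of their weights. -/
def energy (π : ℕ → V) (n : ℕ) : ℤ := ∑ i ∈ Finset.range n, G.w (π i)

/-- The mean-payoff value of an infinite path (the sequence of averages is bounded, as there are
finitely many vertices in the games that are considered). -/
noncomputable def meanPayoff (π : ℕ → V) : ℝ :=
  Filter.liminf (fun n : ℕ => (G.energy π n : ℝ) / (n : ℝ)) Filter.atTop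

/-- The mean-payoff value of the outcome of two strategies from `v₀`. -/
noncomputable def outcomeValue (tie : TieBreaking V) (v₀ : V) (fm fM : G.Strategy) : ℝ :=
  G.meanPayoff fun n => (G.out tie v₀ fm fM n).last

/-- With budget `B` at `v` (and budget `1 - B` for Max), Min can guarantee a non-positive mean-payoff
value. -/
def MinGuarantees (tie : TieBreaking V) (v : V) (B : ℝ) : Prop :=
  ∃ fm : G.Strategy, G.LegalMin tie B fm ∧
    ∀ fM : G.Strategy, G.LegalMax tie (1 - B) fM → G.outcomeValue tie v fm fM ≤ 0

/-- With budget `B` at `v` (and budget `1 - B` for Min), Max can guarantee a strictly positive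
mean-payoff value. -/
def MaxGuarantees (tie : TieBreaking V) (v : V) (B : ℝ) : Prop :=
  ∃ fM : G.Strategy, G.LegalMax tie B fM ∧
    ∀ fm : G.Strategy, G.LegalMin tie (1 - B) fm → 0 < G.outcomeValue tie v fm fM

/-- `t` is a threshold budget at the vertex `v`. -/
def IsThreshold (tie : TieBreaking V) (v : V) (t : ℝ) : Prop :=
  t ∈ Set.Icc (0 : ℝ) 1 ∧
    (∀ B ∈ Set.Icc (0 : ℝ) 1, t < B → G.MinGuarantees tie v B) ∧
    (∀ B ∈ Set.Icc (0 : ℝ) 1, 1 - t < B → G.MaxGuarantees tie v B)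

/-- The edges of the graph that is obtained by splitting `u` into a copy `u_s = some u` without
incoming edges and a copy `u_t = none` without outgoing edges; a vertex `v ≠ u` is `some v`. -/
def splitE (u : V) : Option V → Option V → Prop
  | some v, some v' => v' ≠ u ∧ G.E v v'
  | some v, none => G.E v u
  | none, _ => False

/-- `W` is a weighted Richman function with respect to `u`: on the graph in which `u` is split,
`W u_t = 0`, and `W v = (W v⁺ + W v⁻) / 2 + w v` for every `v ≠ u_t`, where `v⁺` and `v⁻` are
successors of `v` with maximal and minimal value. The weighted Richman value of `u` is `W u_s`. -/
def IsWeightedRichman (u : V) (W : Option V → ℚ) : Prop :=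
  W none = 0 ∧
    ∀ v : V, ∃ vPlus vMinus : Option V,
      G.splitE u (some v) vPlus ∧ G.splitE u (some v) vMinus ∧
      (∀ x, G.splitE u (some v) x → W vMinus ≤ W x ∧ W x ≤ W vPlus) ∧
      W (some v) = (1 / 2) * (W vPlus + W vMinus) + (G.w v : ℚ)

end MeanPayoffGame

/-! A weighted Richman function with `W u_s ≤ 0` is a potential on `V`: since arriving at `u` (value
`0`) resets the potential to `W u_s`, gluing the two copies never raises it. With strength `s v = (W
v⁺ - W v⁻) / 2`, a round changes energy plus potential by at most `s v`, and by at most `-s v` if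
Min moves to `v⁻`. Min bids the fraction `a n * s v` of his budget, so the logarithm of the budget
grows by about `a n * x n`, where `x n = ± s v` bounds the change. As his budget never exceeds `1`,
`∑ a i * x i` is bounded up to a multiple of `∑ a i ^ 2` (`exists_gains_of_follows`). Taking `a n`
proportional to `1 / (n + 1)` keeps the averages of `x`, hence of the energy, from staying above a
positive constant.

If no Richman value is nonpositive, compactness leaves a positive value after subtracting some `ε >
0` from all weights. Max then plays symmetrically with a constant fraction, and `ε` pays for the
quadratic loss.

Real Richman functions come from Knaster–Tarski and an a priori bound; a `ℚ`-linear map makes them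
rational. -/

/-! ### Passing from real to rational solutions -/

/-- A `ℚ`-linear retraction of `ℝ` onto `ℚ` that preserves the sign of finitely many positive
reals. -/
theorem exists_rat_linearMap_pos {ι : Type*} [Finite ι] (r : ι → ℝ) :
    ∃ φ : ℝ →ₗ[ℚ] ℚ, φ 1 = 1 ∧ ∀ i, 0 < r i → 0 < φ (r i) := by
  classical
  let b := Module.Basis.ofVectorSpace ℚ ℝ
  let J := Module.Basis.ofVectorSpaceIndex ℚ ℝ
  -- `ψ s x` replaces the Hamel basis by the family `x`. It depends on finitely many coordinates, so
  -- the required signs, which hold at the true basis, persist on a neighbourhood, and this contains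
  -- a rational family.
  let ψ : ℝ → (J → ℝ) → ℝ := fun s x => (b.repr s).sum fun j q => (q : ℝ) * x j
  have hψc : ∀ s, Continuous (ψ s) := by
    intro s
    simp only [ψ, Finsupp.sum]
    fun_prop
  have hψb : ∀ s, ψ s b = s := by
    intro s
    have := b.linearCombination_repr s
    simpa [ψ, Finsupp.linearCombination_apply, Rat.smul_def] using this
  let O : Set (J → ℝ) := {x | 0 < ψ 1 x} ∩ ⋂ i, {x | 0 < r i → 0 < ψ (r i) x}
  have hO : IsOpen O := by
    refine (isOpen_lt continuous_const (hψc 1)).inter (isOpen_iInter_of_finite fun i => ?_)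
    by_cases h : 0 < r i
    · simpa [h] using isOpen_lt continuous_const (hψc (r i))
    · simp [h]
  have hbO : (b : J → ℝ) ∈ O := by
    refine ⟨by simp [hψb], Set.mem_iInter.2 fun i hi => by simpa [hψb] using hi⟩
  have hd : DenseRange (Pi.map fun (_ : J) (q : ℚ) => (q : ℝ)) :=
    DenseRange.piMap fun _ => Rat.denseRange_cast
  obtain ⟨q, hq⟩ := hd.exists_mem_open hO ⟨_, hbO⟩
  let φ : ℝ →ₗ[ℚ] ℚ := b.constr ℚ q
  have hφ : ∀ s, ψ s (Pi.map (fun (_ : J) (q : ℚ) => (q : ℝ)) q) = (φ s : ℝ) := by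
    intro s
    simp only [φ, ψ, Module.Basis.constr_apply, Finsupp.sum, Pi.map_apply]
    push_cast [smul_eq_mul]
    rfl
  have h1 : 0 < φ 1 := by
    have := hq.1
    simp only [Set.mem_ofPred_eq, hφ] at this
    exact_mod_cast this
  refine ⟨(φ 1)⁻¹ • φ, by simp [h1.ne'], fun i hi => ?_⟩
  have := Set.mem_iInter.1 hq.2 i hi
  rw [hφ] at this
  have : 0 < φ (r i) := by exact_mod_cast this
  simp only [LinearMap.smul_apply, smul_eq_mul]
  positivity

/-! ### Analytic estimates for the betting argument -/

/-- The logarithmic-growth estimate for a gambler who wagers a small fraction of his wealth. -/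
theorem exp_sub_two_mul_sq_le {y : ℝ} (hy : |y| ≤ 1 / 2) : Real.exp (y - 2 * y ^ 2) ≤ 1 + y := by
  obtain ⟨h1, h2⟩ := abs_le.1 hy
  have h0 : 0 < 1 + y := by linarith
  rw [← Real.le_log_iff_exp_le h0]
  refine le_trans ?_ (Real.one_sub_inv_le_log_of_pos h0)
  rw [← sub_nonneg]
  have : 1 - (1 + y)⁻¹ - (y - 2 * y ^ 2) = y ^ 2 * (1 + 2 * y) / (1 + y) := by
    field_simp; ring
  rw [this]
  have : 0 ≤ 1 + 2 * y := by linarith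
  positivity

/-- If the sums `∑ xᵢ / (i + 1)` are bounded above, then the averages of `x` are not bounded away
from `0` from below. -/
theorem not_forall_mul_le_sum_of_sum_div_le {x : ℕ → ℝ} {D δ : ℝ} (hδ : 0 < δ) {N : ℕ}
    (hD : ∀ n, ∑ i ∈ Finset.range n, x i / (i + 1) ≤ D) :
    ¬ ∀ n, N ≤ n → δ * n ≤ ∑ i ∈ Finset.range n, x i := by
  intro h
  set Q : ℕ → ℝ := fun n => ∑ i ∈ Finset.range n, x i / (i + 1) with hQ
  set X : ℕ → ℝ := fun n => ∑ i ∈ Finset.range n, x i with hX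
  set H : ℕ → ℝ := fun n => ∑ i ∈ Finset.range n, (1 : ℝ) / (i + 1) with hH
  set M := N + 1
  -- Summation by parts: one step raises `Q n - X n / n` by `X n / (n * (n + 1)) ≥ δ / (n + 1)`, so
  -- it grows like the harmonic series.
  have key : ∀ n, M ≤ n → Q M - X M / M + δ * (H n - H M) ≤ Q n - X n / n := by
    intro n hn
    induction n, hn using Nat.le_induction with
    | base => simp
    | succ n hn ih =>
      have hn0 : (0 : ℝ) < n := by exact_mod_cast (by omega : 0 < n)
      have e1 : Q (n + 1) = Q n + x n / (n + 1) := by simp [hQ, Finset.sum_range_succ]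
      have e2 : X (n + 1) = X n + x n := by simp [hX, Finset.sum_range_succ]
      have e3 : H (n + 1) = H n + 1 / (n + 1) := by simp [hH, Finset.sum_range_succ]
      have h4 : δ * n ≤ X n := h n (by omega)
      have h5 : δ * (1 / (n + 1)) ≤ X n / n - X n / (n + 1) := by
        have : X n / n - X n / (n + 1) - δ * (1 / (n + 1))
            = (X n - δ * n) / (n * (n + 1)) := by field_simp; ring
        rw [← sub_nonneg, this]
        exact div_nonneg (by linarith) (by positivity)
      rw [e1, e2, e3]
      push_cast
      rw [add_div]
      linarith
  have hlim : Filter.Tendsto H Filter.atTop Filter.atTop :=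
    Real.tendsto_sum_range_one_div_nat_succ_atTop
  obtain ⟨n, hn, hnM⟩ := ((hlim.eventually_gt_atTop
    (H M + (D - (Q M - X M / M)) / δ)).and (Filter.eventually_ge_atTop M)).exists
  have h1 := key n hnM
  have h2 : 0 ≤ X n / n := div_nonneg ((by positivity : 0 ≤ δ * n).trans (h n (by omega)))
    (by positivity)
  have h3 := hD n
  have h4 : (D - (Q M - X M / M)) / δ < H n - H M := by linarith
  rw [div_lt_iff₀ hδ] at h4
  have : Q n ≤ D := h3
  linarith

/-! ### Existence and compactness of Richman functions -/

namespace MeanPayoffGame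

variable {V : Type*} (G : MeanPayoffGame V)

/-- The weighted Richman functions with respect to `u`, for real weights `ω`. -/
def IsRealRichman (u : V) (ω : V → ℝ) (W : Option V → ℝ) : Prop :=
  W none = 0 ∧
    ∀ v : V, ∃ vPlus vMinus : Option V,
      G.splitE u (some v) vPlus ∧ G.splitE u (some v) vMinus ∧
      (∀ x, G.splitE u (some v) x → W vMinus ≤ W x ∧ W x ≤ W vPlus) ∧
      W (some v) = (1 / 2) * (W vPlus + W vMinus) + ω v

variable {G}

/-- The Richman conditions are `ℚ`-linear equations and comparisons between finitely many reals. A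
`ℚ`-linear map fixing `1` and preserving the signs of all differences transports them. -/
theorem IsRealRichman.exists_rat [Finite V] {u : V} {W : Option V → ℝ}
    (hW : G.IsRealRichman u (fun v => (G.w v : ℝ)) W) :
    ∃ W' : Option V → ℚ, G.IsWeightedRichman u W' ∧ (W (some u) ≤ 0 → W' (some u) ≤ 0) := by
  obtain ⟨φ, hφ1, hφ⟩ := exists_rat_linearMap_pos fun p : Option V × Option V => W p.1 - W p.2
  have hle : ∀ x y, W x ≤ W y → φ (W x) ≤ φ (W y) := by
    intro x y hxy
    rcases hxy.eq_or_lt with h | h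
    · rw [h]
    · have := hφ (y, x) (sub_pos.2 h)
      simp only [map_sub] at this
      linarith
  have h0 : φ (W none) = 0 := by rw [hW.1, map_zero]
  refine ⟨fun x => φ (W x), ⟨h0, fun v => ?_⟩, fun h => ?_⟩
  · obtain ⟨p, m, hp, hm, hpm, e⟩ := hW.2 v
    refine ⟨p, m, hp, hm, fun x hx => ⟨hle _ _ (hpm x hx).1, hle _ _ (hpm x hx).2⟩, ?_⟩
    have e' : W (some v) = (1 / 2 : ℚ) • (W p + W m) + (G.w v : ℚ) • (1 : ℝ) := by
      rw [e]; simp [Rat.smul_def, mul_add]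
    show φ (W (some v)) = _
    rw [e', map_add, map_smul, map_smul, map_add, hφ1]
    simp
  · have := hle (some u) none (by rwa [hW.1])
    simpa [h0] using this

theorem IsWeightedRichman.isRealRichman {u : V} {W : Option V → ℚ}
    (hW : G.IsWeightedRichman u W) :
    G.IsRealRichman u (fun v => (G.w v : ℝ)) fun x => (W x : ℝ) := by
  refine ⟨by simp [hW.1], fun v => ?_⟩
  obtain ⟨p, m, hp, hm, hpm, e⟩ := hW.2 v
  refine ⟨p, m, hp, hm, fun x hx => ?_, by simp [e]⟩
  simpa using hpm x hx

/-- A walk to `u`, cut at its first arrival there, is a walk to `u_t`. Starting from `u_s` it must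
have at least one edge, hence `TransGen`. -/
theorem StronglyConnected.splitE_reflTransGen (hG : G.StronglyConnected) (u : V) (x : Option V) :
    Relation.ReflTransGen (G.splitE u) x none := by
  cases x with
  | none => exact .refl
  | some v =>
    have hv : Relation.TransGen G.E v u :=
      (G.serial v).elim fun v' h => .head' h (hG v' u)
    induction hv using Relation.TransGen.head_induction_on with
    | single h => exact .single h
    | @head a c h _ ih =>
      by_cases hc : c = u
      · subst hc
        exact .single h
      · exact .head (show G.splitE u (some a) (some c) from ⟨hc, h⟩) ih

/-- A subsolution of the Richman equations is bounded at the target of a path if it is large at the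
source. -/
theorem exists_bound_of_path {u : V} {x : Option V} (K : ℝ)
    (hx : Relation.ReflTransGen (G.splitE u) x none) (d : ℝ) :
    ∃ c, ∀ (W : Option V → ℝ) (M : ℝ), W none = 0 →
      (∀ v y, G.splitE u (some v) y → 0 < W (some v) → W (some v) ≤ 1 / 2 * (M + W y) + K) →
      M - d ≤ W x → M ≤ c := by
  induction hx using Relation.ReflTransGen.head_induction_on generalizing d with
  | refl => exact ⟨d, fun W M h0 _ h => by linarith⟩
  | @head x y hxy _ ih =>
    cases x with
    | none => exact hxy.elim
    | some v =>
      -- If `W v` is within `d` of `M`, the averaging inequality puts `W y` within `2 * d + 2 * K`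
      -- of `M`. Positivity of `W v` comes from `M > d`.
      obtain ⟨c, hc⟩ := ih (2 * d + 2 * K)
      refine ⟨max d c, fun W M h0 hW h => ?_⟩
      by_cases hM : M ≤ d
      · exact hM.trans (le_max_left _ _)
      · refine (hc W M h0 hW ?_).trans (le_max_right _ _)
        have := hW v y hxy (by linarith)
        linarith

/-- `M` will be the maximum of `W`. The inequality is demanded only where `W` is positive so that it
survives truncation: the lower clamp affects only negative values. -/
theorem StronglyConnected.exists_bound [Finite V] (hG : G.StronglyConnected) (u : V) (K : ℝ) :
    ∃ c, ∀ (W : Option V → ℝ) (M : ℝ), W none = 0 →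
      (∀ v y, G.splitE u (some v) y → 0 < W (some v) → W (some v) ≤ 1 / 2 * (M + W y) + K) →
      (∃ x, M ≤ W x) → M ≤ c := by
  choose c hc using fun x => exists_bound_of_path (G := G) K (hG.splitE_reflTransGen u x) 0
  obtain ⟨C, hC⟩ := (Set.finite_range c).bddAbove
  refine ⟨C, fun W M h0 hW ⟨x, hx⟩ => (hc x W M h0 hW (by simpa using hx)).trans (hC ⟨x, rfl⟩)⟩

section Operator

open Classical in
/-- The successors of `v` in the graph that is obtained by splitting `u`. -/
noncomputable def splitSucc [Fintype V] (G : MeanPayoffGame V) (u v : V) : Finset (Option V) :=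
  Finset.univ.filter (G.splitE u (some v))

theorem mem_splitSucc [Fintype V] {u v : V} {x : Option V} :
    x ∈ G.splitSucc u v ↔ G.splitE u (some v) x := by simp [splitSucc]

theorem splitSucc_nonempty [Fintype V] (G : MeanPayoffGame V) (u v : V) :
    (G.splitSucc u v).Nonempty := by
  obtain ⟨v', h⟩ := G.serial v
  by_cases hu : v' = u
  · exact ⟨none, mem_splitSucc.2 (hu ▸ h)⟩
  · exact ⟨some v', mem_splitSucc.2 ⟨hu, h⟩⟩

/-- The operator whose fixed points are the weighted Richman functions. -/
noncomputable def richmanOp [Fintype V] (G : MeanPayoffGame V) (u : V) (ω : V → ℝ)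
    (W : Option V → ℝ) : Option V → ℝ
  | none => 0
  | some v => 1 / 2 * ((G.splitSucc u v).sup' (G.splitSucc_nonempty u v) W +
      (G.splitSucc u v).inf' (G.splitSucc_nonempty u v) W) + ω v

variable [Fintype V] {u : V} {ω : V → ℝ} {W : Option V → ℝ}

theorem isRealRichman_of_richmanOp_eq (h : G.richmanOp u ω W = W) : G.IsRealRichman u ω W := by
  refine ⟨by rw [← h]; rfl, fun v => ?_⟩
  obtain ⟨p, hp, ep⟩ := Finset.exists_mem_eq_sup' (G.splitSucc_nonempty u v) W
  obtain ⟨m, hm, em⟩ := Finset.exists_mem_eq_inf' (G.splitSucc_nonempty u v) W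
  refine ⟨p, m, mem_splitSucc.1 hp, mem_splitSucc.1 hm, fun x hx => ⟨?_, ?_⟩, ?_⟩
  · rw [← em]; exact Finset.inf'_le _ (mem_splitSucc.2 hx)
  · rw [← ep]; exact Finset.le_sup' _ (mem_splitSucc.2 hx)
  · rw [← em, ← ep]; exact (congrFun h (some v)).symm

theorem richmanOp_mono : Monotone (G.richmanOp u ω) := by
  intro W W' h x
  cases x with
  | none => exact le_rfl
  | some v =>
    have h1 := Finset.sup'_mono_fun (hs := G.splitSucc_nonempty u v) fun x _ => h x
    have h2 := Finset.inf'_mono_fun (hs := G.splitSucc_nonempty u v) fun x _ => h x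
    simp only [richmanOp]
    linarith

theorem continuous_richmanOp :
    Continuous fun p : (V → ℝ) × (Option V → ℝ) => G.richmanOp u p.1 p.2 := by
  refine continuous_pi fun x => ?_
  cases x with
  | none => exact continuous_const
  | some v =>
    simp only [richmanOp]
    refine .add (.mul continuous_const (.add ?_ ?_)) (by fun_prop)
    · exact Continuous.finset_sup'_apply _ fun x _ => by fun_prop
    · exact Continuous.finset_inf'_apply _ fun x _ => by fun_prop

theorem richmanOp_le {M : ℝ} (hM : ∀ x, W x ≤ M) {v : V} {y : Option V}
    (hy : G.splitE u (some v) y) : G.richmanOp u ω W (some v) ≤ 1 / 2 * (M + W y) + ω v := by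
  have h1 := Finset.sup'_le (G.splitSucc_nonempty u v) W fun x _ => hM x
  have h2 := Finset.inf'_le W (mem_splitSucc.2 hy)
  simp only [richmanOp]
  linarith

theorem le_richmanOp {M : ℝ} (hM : ∀ x, M ≤ W x) {v : V} {y : Option V}
    (hy : G.splitE u (some v) y) : 1 / 2 * (M + W y) + ω v ≤ G.richmanOp u ω W (some v) := by
  have h1 := Finset.le_inf' (G.splitSucc_nonempty u v) W fun x _ => hM x
  have h2 := Finset.le_sup' W (mem_splitSucc.2 hy)
  simp only [richmanOp]
  linarith

/-- Weighted Richman functions exist for all real weights, and are bounded in terms of the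
weights. -/
theorem StronglyConnected.exists_richmanOp_eq (hG : G.StronglyConnected) (u : V) (K : ℝ) :
    ∃ c, ∀ ω : V → ℝ, (∀ v, |ω v| ≤ K) →
      ∃ W : Option V → ℝ, G.richmanOp u ω W = W ∧ ∀ x, |W x| ≤ c := by
  obtain ⟨c, hc⟩ := hG.exists_bound u K
  -- A function negative off `u_t` satisfies the hypothesis vacuously.
  have hc0 : 0 ≤ c := hc (fun x => if x = none then 0 else -|K| - 1) 0 (by simp)
    (fun v y _ h => by simp at h; linarith [abs_nonneg K]) ⟨none, by simp⟩
  refine ⟨c, fun ω hω => ?_⟩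
  have hC : -(c + 1) ≤ c + 1 := by linarith
  have : Fact (-(c + 1) ≤ c + 1) := ⟨hC⟩
  -- Truncation gives a monotone self-map of a complete lattice. The a priori bound, applied to `W`
  -- and `-W`, puts its fixed point strictly inside the box, where truncation is inactive.
  let T : (Option V → Set.Icc (-(c + 1)) (c + 1)) →o (Option V → Set.Icc (-(c + 1)) (c + 1)) :=
    { toFun := fun f x => Set.projIcc _ _ hC (G.richmanOp u ω (fun y => (f y : ℝ)) x)
      monotone' := fun f g h x => Set.monotone_projIcc hC (richmanOp_mono (fun y => h y) x) }
  obtain ⟨f, hf⟩ : ∃ f, T f = f := ⟨T.lfp, T.map_lfp⟩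
  set W : Option V → ℝ := fun x => (f x : ℝ) with hWdef
  have hW : ∀ x, W x = max (-(c + 1)) (min (c + 1) (G.richmanOp u ω W x)) := by
    intro x
    have := congrArg Subtype.val (congrFun hf x)
    exact this.symm.trans (Set.coe_projIcc _ _ hC _)
  have h0 : W none = 0 := by
    rw [hW, richmanOp, min_eq_right (by linarith), max_eq_right (by linarith)]
  obtain ⟨xM, hxM⟩ := Finite.exists_max W
  obtain ⟨xm, hxm⟩ := Finite.exists_min W
  have hup : W xM ≤ c := by
    refine hc W _ h0 (fun v y hy hv => ?_) ⟨xM, le_rfl⟩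
    have h1 : W (some v) ≤ G.richmanOp u ω W (some v) := by
      by_contra! hlt
      have := hW (some v)
      have h3 := min_le_right (c + 1) (G.richmanOp u ω W (some v))
      have : W (some v) < W (some v) := by
        conv_lhs => rw [this]
        exact max_lt (by linarith) (by linarith)
      exact lt_irrefl _ this
    linarith [richmanOp_le (ω := ω) hxM hy, (abs_le.1 (hω v)).2]
  have hdown : -W xm ≤ c := by
    refine hc (fun x => -W x) _ (by simp [h0]) (fun v y hy hv => ?_) ⟨xm, le_rfl⟩
    simp only [Left.neg_pos_iff] at hv
    have h1 : G.richmanOp u ω W (some v) ≤ W (some v) := by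
      by_contra! hlt
      have := hW (some v)
      have : W (some v) < W (some v) := by
        conv_rhs => rw [this]
        exact lt_max_of_lt_right (lt_min (by linarith) hlt)
      exact lt_irrefl _ this
    linarith [le_richmanOp (ω := ω) hxm hy, (abs_le.1 (hω v)).1]
  refine ⟨W, funext fun x => ?_, fun x => abs_le.2 ⟨by linarith [hxm x], by linarith [hxM x]⟩⟩
  have h1 := hW x
  have h2 := hxM x
  have h3 := hxm x
  rcases max_cases (-(c + 1)) (min (c + 1) (G.richmanOp u ω W x)) with h | h <;>
    rcases min_cases (c + 1) (G.richmanOp u ω W x) with h' | h' <;> linarith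

end Operator

theorem StronglyConnected.exists_isRealRichman [Finite V] (hG : G.StronglyConnected) (u : V)
    (ω : V → ℝ) : ∃ W, G.IsRealRichman u ω W := by
  have := Fintype.ofFinite V
  obtain ⟨K, hK⟩ := (Set.finite_range fun v => |ω v|).bddAbove
  obtain ⟨c, hc⟩ := hG.exists_richmanOp_eq u K
  obtain ⟨W, hW, -⟩ := hc ω fun v => hK ⟨v, rfl⟩
  exact ⟨W, isRealRichman_of_richmanOp_eq hW⟩

/-- If decreasing the weights makes the Richman values of `u` negative, then `u` has a nonpositive
Richman value for the original weights. -/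
theorem StronglyConnected.exists_isRealRichman_nonpos [Finite V] (hG : G.StronglyConnected) (u : V)
    (ω : V → ℝ)
    (h : ∀ ε : ℝ, 0 < ε → ε ≤ 1 → ∀ W, G.IsRealRichman u (fun v => ω v - ε) W → W (some u) ≤ 0) :
    ∃ W, G.IsRealRichman u ω W ∧ W (some u) ≤ 0 := by
  have := Fintype.ofFinite V
  obtain ⟨K, hK⟩ := (Set.finite_range fun v => |ω v|).bddAbove
  -- One bound serves all perturbations with `ε ≤ 1`, so the perturbed solutions have a convergent
  -- subsequence; joint continuity of the operator makes its limit a solution for `ω`.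
  obtain ⟨c, hc⟩ := hG.exists_richmanOp_eq u (K + 1)
  let ε : ℕ → ℝ := fun n => 1 / ((n : ℝ) + 1)
  have hε0 : ∀ n, 0 < ε n := fun n => by positivity
  have hε1 : ∀ n, ε n ≤ 1 := fun n => by
    simp only [ε]; rw [div_le_one (by positivity)]; linarith [(n.cast_nonneg : (0 : ℝ) ≤ n)]
  choose W hW hWc using fun n => hc (fun v => ω v - ε n) fun v => by
    have h1 : |ω v| ≤ K := hK ⟨v, rfl⟩
    calc |ω v - ε n| ≤ |ω v| + |ε n| := abs_sub _ _
      _ ≤ K + 1 := by rw [abs_of_pos (hε0 n)]; linarith [hε1 n]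
  have hbox : IsCompact (Set.Icc (fun _ => -c) (fun _ => c) : Set (Option V → ℝ)) := isCompact_Icc
  obtain ⟨W₀, -, φ, hφ, hlim⟩ := hbox.tendsto_subseq (x := W) fun n =>
    ⟨fun x => (abs_le.1 (hWc n x)).1, fun x => (abs_le.1 (hWc n x)).2⟩
  have hεlim : Filter.Tendsto (fun n => ε (φ n)) Filter.atTop (nhds 0) :=
    tendsto_one_div_add_atTop_nhds_zero_nat.comp hφ.tendsto_atTop
  have hωlim : Filter.Tendsto (fun n v => ω v - ε (φ n)) Filter.atTop (nhds ω) := by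
    refine tendsto_pi_nhds.2 fun v => ?_
    simpa using tendsto_const_nhds.sub hεlim
  have hT := (continuous_richmanOp (G := G) (u := u)).tendsto (ω, W₀) |>.comp
    (hωlim.prodMk_nhds hlim)
  refine ⟨W₀, isRealRichman_of_richmanOp_eq (tendsto_nhds_unique hT ?_), ?_⟩
  · exact hlim.congr fun n => (hW (φ n)).symm
  · exact le_of_tendsto' (tendsto_pi_nhds.1 hlim (some u)) fun n =>
      h _ (hε0 _) (hε1 _) _ (isRealRichman_of_richmanOp_eq (hW _))

end MeanPayoffGame

/-! ### Fractional betting strategies -/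

namespace History

variable {V : Type*}

/-- The number of rounds of a history. -/
def rounds : History V → ℕ
  | init _ => 0
  | step h _ _ _ => rounds h + 1

end History

namespace MeanPayoffGame

variable {V : Type*} {G : MeanPayoffGame V}

/-- `h'` is a possible continuation of `h` by one round in which Player `p` follows `f`. -/
def Follows (p : Player) (f : G.Strategy) (h h' : History V) : Prop :=
  ∃ v b i, h' = h.step v b i ∧ G.E h.last v ∧
    ((i = p ∧ b = (f.act h).1 ∧ v = (f.act h).2) ∨ (i ≠ p ∧ (f.act h).1 ≤ b))

/-- This removes tie-breaking from the analysis: a player who loses a round receives at least his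
own bid, even in a tie. -/
theorem follows_next (tie : TieBreaking V) (fm fM : G.Strategy) (h : History V) :
    Follows .min fm h (G.next tie fm fM h) ∧ Follows .max fM h (G.next tie fm fM h) := by
  simp only [next]
  split_ifs with h1 h2
  · exact ⟨⟨_, _, _, rfl, fm.edge h, .inl ⟨rfl, rfl, rfl⟩⟩,
      ⟨_, _, _, rfl, fm.edge h, .inr ⟨by simp, h1.le⟩⟩⟩
  · exact ⟨⟨_, _, _, rfl, fM.edge h, .inr ⟨by simp, h2.le⟩⟩,
      ⟨_, _, _, rfl, fM.edge h, .inl ⟨rfl, rfl, rfl⟩⟩⟩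
  · cases tie h (fm.act h) (fM.act h)
    · exact ⟨⟨_, _, _, rfl, fm.edge h, .inl ⟨rfl, rfl, rfl⟩⟩,
        ⟨_, _, _, rfl, fm.edge h, .inr ⟨by simp, not_lt.1 h2⟩⟩⟩
    · exact ⟨⟨_, _, _, rfl, fM.edge h, .inr ⟨by simp, not_lt.1 h1⟩⟩,
        ⟨_, _, _, rfl, fM.edge h, .inl ⟨rfl, rfl, rfl⟩⟩⟩

theorem payment_max (h : History V) : h.payment .max = -h.payment .min := by
  induction h with
  | init => simp [History.payment]
  | step h v b i ih => cases i <;> simp [History.payment, ih] <;> ring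

/-- The strategy that wagers the fraction `a n * s v` of the current budget in round `n` at the
vertex `v`, and moves to `best v`. -/
noncomputable def fractionStrategy (p : Player) (B : ℝ) (a : ℕ → ℝ) (s : V → ℝ) (best : V → V)
    (hbest : ∀ v, G.E v (best v)) : G.Strategy where
  act h := (Set.projIcc 0 1 zero_le_one (a h.rounds * s h.last * (B - h.payment p)), best h.last)
  edge h := hbest h.last

section Fraction

variable {p : Player} {B : ℝ} {a : ℕ → ℝ} {s : V → ℝ} {best : V → V}
  {hbest : ∀ v, G.E v (best v)}

theorem fractionStrategy_bid_le {h : History V} (ha : a h.rounds * s h.last ≤ 1)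
    (hB : 0 ≤ B - h.payment p) :
    (((fractionStrategy p B a s best hbest).act h).1 : ℝ) ≤ B - h.payment p := by
  simp only [fractionStrategy, Set.coe_projIcc]
  refine max_le hB ((min_le_right _ _).trans ?_)
  exact mul_le_of_le_one_left hB ha

theorem budget_nonneg_of_follows (ha : ∀ n v, a n * s v ≤ 1) (hB : 0 ≤ B) {v₀ : V}
    {H : ℕ → History V} (h0 : H 0 = .init v₀)
    (hH : ∀ n, Follows p (fractionStrategy p B a s best hbest) (H n) (H (n + 1))) (n : ℕ) :
    0 ≤ B - (H n).payment p := by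
  induction n with
  | zero => simpa [h0, History.payment] using hB
  | succ n ih =>
    obtain ⟨v, b, i, e, -, ⟨hi, hb, -⟩ | ⟨hi, -⟩⟩ := hH n
    · have := fractionStrategy_bid_le (best := best) (hbest := hbest) (ha _ _) ih
      rw [← hb] at this
      simp only [e, History.payment, hi, if_true]
      linarith
    · have := b.2.1
      simp only [e, History.payment, hi, if_false]
      linarith

theorem legalMin_fractionStrategy (tie : TieBreaking V) (ha : ∀ n v, a n * s v ≤ 1) (hB : 0 ≤ B) :
    G.LegalMin tie B (fractionStrategy .min B a s best hbest) := fun v₀ fM n =>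
  fractionStrategy_bid_le (ha _ _) <| budget_nonneg_of_follows ha hB (v₀ := v₀)
    (H := G.out tie v₀ (fractionStrategy .min B a s best hbest) fM) rfl
    (fun _ => (follows_next tie _ _ _).1) n

theorem legalMax_fractionStrategy (tie : TieBreaking V) (ha : ∀ n v, a n * s v ≤ 1) (hB : 0 ≤ B) :
    G.LegalMax tie B (fractionStrategy .max B a s best hbest) := fun v₀ fm n =>
  fractionStrategy_bid_le (ha _ _) <| budget_nonneg_of_follows ha hB (v₀ := v₀)
    (H := G.out tie v₀ fm (fractionStrategy .max B a s best hbest)) rfl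
    (fun _ => (follows_next tie _ _ _).2) n

/-- The effect of fractional wagers against an opponent who stays within his budget: the cost `c` of
the outcome exceeds the potential difference at most by a sum of gains and losses, whose sum weighted
with the fractions `a` is controlled by the budget. -/
theorem exists_gains_of_follows {c U : V → ℝ} {S : ℝ} (ha0 : ∀ n, 0 ≤ a n)
    (haS : ∀ n, a n * S ≤ 1 / 2) (hs0 : ∀ v, 0 ≤ s v) (hsS : ∀ v, s v ≤ S)
    (hU : ∀ v x, G.E v x → c v + U x ≤ U v + s v) (hUbest : ∀ v, c v + U (best v) ≤ U v - s v)
    (hB : 0 < B) {v₀ : V} {H : ℕ → History V} (h0 : H 0 = .init v₀)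
    (hH : ∀ n, Follows p (fractionStrategy p B a s best hbest) (H n) (H (n + 1)))
    (hH1 : ∀ n, B - (H n).payment p ≤ 1) :
    ∃ x : ℕ → ℝ,
      (∀ n, ∑ i ∈ Finset.range n, c (H i).last + U (H n).last ≤
        U v₀ + ∑ i ∈ Finset.range n, x i) ∧
      ∀ n, ∑ i ∈ Finset.range n, a i * x i ≤
        -Real.log B + 2 * S ^ 2 * ∑ i ∈ Finset.range n, a i ^ 2 := by
  have hsS' : ∀ n v, a n * s v ≤ 1 / 2 := fun n v =>
    (mul_le_mul_of_nonneg_left (hsS v) (ha0 n)).trans (haS n)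
  have hb0 := budget_nonneg_of_follows (fun n v => (hsS' n v).trans (by norm_num)) hB.le h0 hH
  have hlen : ∀ n, (H n).rounds = n := by
    intro n
    induction n with
    | zero => rw [h0]; rfl
    | succ n ih =>
      obtain ⟨v, b, i, e, -⟩ := hH n
      rw [e, History.rounds, ih]
  -- The clamp to `[0, 1]` is inactive because the budget stays in `[0, 1]`.
  have hbid : ∀ n, (((fractionStrategy p B a s best hbest).act (H n)).1 : ℝ) =
      a n * s (H n).last * (B - (H n).payment p) := by
    intro n
    have h1 : 0 ≤ a n * s (H n).last := mul_nonneg (ha0 n) (hs0 _)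
    simp only [fractionStrategy, Set.coe_projIcc, hlen]
    rw [min_eq_right, max_eq_right (mul_nonneg h1 (hb0 n))]
    exact mul_le_one₀ ((hsS' _ _).trans (by norm_num)) (hb0 n) (hH1 n)
  -- `y` is `-s` after a won round and `s` after a lost one; the budget is multiplied by at least `1
  -- + a n * y`.
  have hstep : ∀ n, ∃ y, |y| ≤ s (H n).last ∧
      c (H n).last + U (H (n + 1)).last ≤ U (H n).last + y ∧
      (B - (H n).payment p) * (1 + a n * y) ≤ B - (H (n + 1)).payment p := by
    intro n
    obtain ⟨v, b, i, e, hE, ⟨hi, hb, hv⟩ | ⟨hi, hb⟩⟩ := hH n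
    · refine ⟨-s (H n).last, by rw [abs_neg, abs_of_nonneg (hs0 _)], ?_, ?_⟩
      · rw [e, hv]
        exact hUbest _
      · simp only [e, History.payment, hi, if_true, hb, hbid]
        linarith
    · refine ⟨s (H n).last, by rw [abs_of_nonneg (hs0 _)], ?_, ?_⟩
      · rw [e]
        exact hU _ _ hE
      · have hb' : (((fractionStrategy p B a s best hbest).act (H n)).1 : ℝ) ≤ b := hb
        rw [hbid] at hb'
        simp only [e, History.payment, hi, if_false]
        linarith
  choose x hx1 hx2 hx3 using hstep
  refine ⟨x, fun n => ?_, fun n => ?_⟩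
  · induction n with
    | zero => simp [h0, History.last]
    | succ n ih =>
      rw [Finset.sum_range_succ, Finset.sum_range_succ]
      linarith [hx2 n]
  · have hgrow : B * Real.exp (∑ i ∈ Finset.range n, (a i * x i - 2 * (S ^ 2 * a i ^ 2))) ≤
        B - (H n).payment p := by
      induction n with
      | zero => simp [h0, History.payment]
      | succ n ih =>
        have hxS : |x n| ≤ S := (hx1 n).trans (hsS _)
        have h1 : |a n * x n| ≤ a n * S := by
          rw [abs_mul, abs_of_nonneg (ha0 n)]
          exact mul_le_mul_of_nonneg_left hxS (ha0 n)
        have h2 : (a n * x n) ^ 2 ≤ S ^ 2 * a n ^ 2 := by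
          rw [← mul_pow, mul_comm S]
          exact sq_le_sq.2 (h1.trans (le_abs_self _))
        have h3 : Real.exp (a n * x n - 2 * (S ^ 2 * a n ^ 2)) ≤ 1 + a n * x n :=
          (Real.exp_le_exp.2 (by linarith)).trans
            (exp_sub_two_mul_sq_le (h1.trans (haS n)))
        rw [Finset.sum_range_succ, Real.exp_add, ← mul_assoc]
        exact (mul_le_mul ih h3 (Real.exp_pos _).le (hb0 n)).trans (hx3 n)
    have h1 := hgrow.trans (hH1 n)
    rw [← Real.exp_log hB, ← Real.exp_add, Real.exp_le_one_iff, Finset.sum_sub_distrib,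
      ← Finset.mul_sum, ← Finset.mul_sum] at h1
    linarith

end Fraction

/-! ### Mean payoff and potentials -/

section Value

variable [Finite V]

/-- Boundedness of the averages is what makes the real-valued `Filter.liminf` behave as expected. -/
theorem exists_abs_energy_div_le (G : MeanPayoffGame V) :
    ∃ K : ℝ, ∀ π n, |(G.energy π n : ℝ) / n| ≤ K := by
  obtain ⟨K, hK⟩ := (Set.finite_range fun v => |(G.w v : ℝ)|).bddAbove
  refine ⟨max K 0, fun π n => ?_⟩
  rw [abs_div, Nat.abs_cast]
  refine div_le_of_le_mul₀ (by positivity) (le_max_right _ _) ?_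
  rw [energy, Int.cast_sum]
  refine (Finset.abs_sum_le_sum_abs _ _).trans ?_
  refine (Finset.sum_le_card_nsmul _ _ (max K 0) fun i _ =>
    (hK ⟨π i, rfl⟩).trans (le_max_left _ _)).trans ?_
  simp [mul_comm]

theorem exists_le_energy_of_meanPayoff_pos {π : ℕ → V} (h : 0 < G.meanPayoff π) :
    ∃ δ : ℝ, 0 < δ ∧ ∃ N : ℕ, ∀ n, N ≤ n → δ * n ≤ G.energy π n := by
  obtain ⟨K, hK⟩ := G.exists_abs_energy_div_le
  obtain ⟨δ, h0, hδ⟩ := exists_between h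
  refine ⟨δ, h0, ?_⟩
  have := Filter.eventually_lt_of_lt_liminf hδ
    (Filter.isBoundedUnder_of ⟨-K, fun n => (abs_le.1 (hK π n)).1⟩)
  obtain ⟨N, hN⟩ := Filter.eventually_atTop.1 this
  refine ⟨N + 1, fun n hn => ?_⟩
  have hn0 : (0 : ℝ) < n := by exact_mod_cast (by omega : 0 < n)
  exact ((lt_div_iff₀ hn0).1 (hN n (by omega))).le

theorem meanPayoff_pos_of_le_energy {π : ℕ → V} {δ D : ℝ} (hδ : 0 < δ)
    (h : ∀ n : ℕ, δ * n - D ≤ G.energy π n) : 0 < G.meanPayoff π := by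
  obtain ⟨K, hK⟩ := G.exists_abs_energy_div_le
  refine (half_pos hδ).trans_le (Filter.le_liminf_of_le
    (Filter.isBoundedUnder_of ⟨K, fun n => (abs_le.1 (hK π n)).2⟩).isCoboundedUnder_ge ?_)
  obtain ⟨N, hN⟩ := exists_nat_ge (2 * D / δ)
  filter_upwards [Filter.eventually_ge_atTop (N + 1)] with n hn
  have hn0 : (0 : ℝ) < n := by exact_mod_cast (by omega : 0 < n)
  have hn1 : (N : ℝ) ≤ n := by exact_mod_cast (by omega : N ≤ n)
  have h1 := hN.trans hn1
  rw [div_le_iff₀ hδ] at h1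
  rw [le_div_iff₀ hn0]
  linarith [h n]

theorem exists_abs_le_of_finite {ι : Type*} [Finite ι] (f : ι → ℝ) : ∃ M, ∀ v, |f v| ≤ M := by
  obtain ⟨M, hM⟩ := (Set.finite_range fun v => |f v|).bddAbove
  exact ⟨M, fun v => hM ⟨v, rfl⟩⟩

end Value

/-- This is where the sign of `F u_s` enters: entering `u` leads to `u_t` in the split graph, and
identifying it with `u_s` does not raise `F`. -/
theorem le_of_splitE {u : V} {F : Option V → ℝ} (h0 : F none = 0) (hu : F (some u) ≤ 0) {v x : V}
    (h : G.E v x) : ∃ y, G.splitE u (some v) y ∧ F (some x) ≤ F y := by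
  by_cases hx : x = u
  · exact ⟨none, hx ▸ h, by rw [h0, hx]; exact hu⟩
  · exact ⟨some x, ⟨hx, h⟩, le_rfl⟩

theorem exists_edge_of_splitE {u v : V} {y : Option V} (h : G.splitE u (some v) y) :
    ∃ x, G.E v x ∧ (y = some x ∨ y = none ∧ x = u) := by
  cases y with
  | none => exact ⟨u, h, .inr ⟨rfl, rfl⟩⟩
  | some x => exact ⟨x, h.2, .inl rfl⟩

/-- If `F` solves the Richman equations for the costs `c` and is nonpositive at `u`, then it is a
potential: moving to a suitable successor saves the strength of the vertex. -/
theorem IsRealRichman.exists_strength {u : V} {c : V → ℝ} {F : Option V → ℝ}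
    (hF : G.IsRealRichman u c F) (hu : F (some u) ≤ 0) :
    ∃ (s : V → ℝ) (best : V → V), (∀ v, G.E v (best v)) ∧ (∀ v, 0 ≤ s v) ∧
      (∀ v x, G.E v x → c v + F (some x) ≤ F (some v) + s v) ∧
      ∀ v, c v + F (some (best v)) ≤ F (some v) - s v := by
  choose P m hP hm hPm e using hF.2
  choose best hbest hbest' using fun v => exists_edge_of_splitE (hm v)
  refine ⟨fun v => (F (P v) - F (m v)) / 2, best, hbest, fun v => ?_, fun v x hx => ?_,
    fun v => ?_⟩
  · linarith [(hPm v _ (hP v)).1]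
  · obtain ⟨y, hy, hxy⟩ := le_of_splitE hF.1 hu hx
    linarith [(hPm v y hy).2, e v]
  · have : F (some (best v)) ≤ F (m v) := by
      rcases hbest' v with h | ⟨h, h'⟩
      · rw [h]
      · rw [h, h', hF.1]
        exact hu
    linarith [e v]

/-- Negation exchanges the roles of the players, so Max can reuse the potential built for Min. -/
theorem IsRealRichman.neg {u : V} {c : V → ℝ} {F : Option V → ℝ} (hF : G.IsRealRichman u c F) :
    G.IsRealRichman u (fun v => -c v) fun x => -F x := by
  refine ⟨by simp [hF.1], fun v => ?_⟩
  obtain ⟨P, m, hP, hm, hPm, e⟩ := hF.2 v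
  exact ⟨m, P, hm, hP, fun x hx => ⟨neg_le_neg (hPm x hx).2, neg_le_neg (hPm x hx).1⟩, by
    simp only [e]; ring⟩

/-! ### Winning strategies for both players -/

section Guarantees

variable [Finite V]

/-- Min wins with any positive budget if some vertex has a nonpositive Richman value. -/
theorem IsRealRichman.minGuarantees {u : V} {F : Option V → ℝ}
    (hF : G.IsRealRichman u (fun v => (G.w v : ℝ)) F) (hu : F (some u) ≤ 0) (tie : TieBreaking V)
    {B : ℝ} (hB : 0 < B) (v₀ : V) : G.MinGuarantees tie v₀ B := by
  obtain ⟨s, best, hbest, hs0, hU, hUbest⟩ := hF.exists_strength hu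
  obtain ⟨M, hM⟩ := exists_abs_le_of_finite s
  obtain ⟨R, hR⟩ := exists_abs_le_of_finite F
  have hM0 : 0 ≤ M := (abs_nonneg _).trans (hM v₀)
  set S : ℝ := M + 1 with hS
  have hS0 : 0 < S := by positivity
  have hsS : ∀ v, s v ≤ S := fun v => (le_abs_self _).trans ((hM v).trans (by linarith))
  -- The factor `κ` ensures `a n * S ≤ 1 / 2`; the fractions `κ / (n + 1)` are square summable but
  -- not summable.
  let κ : ℝ := 1 / (2 * S)
  have hκ : 0 < κ := by positivity
  let a : ℕ → ℝ := fun n => κ / (n + 1)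
  have ha0 : ∀ n, 0 ≤ a n := fun n => by positivity
  have haS : ∀ n, a n * S ≤ 1 / 2 := by
    intro n
    have : a n * S = 1 / 2 * (1 / ((n : ℝ) + 1)) := by
      simp only [a, κ]; field_simp
    rw [this]
    refine mul_le_of_le_one_right (by norm_num) ?_
    rw [div_le_one (by positivity)]
    linarith [(n.cast_nonneg : (0 : ℝ) ≤ n)]
  have has : ∀ n v, a n * s v ≤ 1 := fun n v =>
    (mul_le_mul_of_nonneg_left (hsS v) (ha0 n)).trans ((haS n).trans (by norm_num))
  refine ⟨fractionStrategy .min B a s best hbest, legalMin_fractionStrategy tie has hB.le,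
    fun fM hfM => ?_⟩
  set fm := fractionStrategy .min B a s best hbest
  by_contra! hpos
  obtain ⟨δ, hδ, N, hN⟩ := exists_le_energy_of_meanPayoff_pos hpos
  -- Legality of Max's strategy keeps his budget nonnegative, hence Min's at most `1`.
  obtain ⟨x, hx1, hx2⟩ := exists_gains_of_follows (p := .min) (c := fun v => (G.w v : ℝ))
    (U := fun v => F (some v)) (hbest := hbest) ha0 haS hs0 hsS hU hUbest hB
    (H := G.out tie v₀ fm fM) rfl (fun _ => (follows_next tie _ _ _).1) fun n => by
      have h1 := hfM v₀ fm n
      have h2 := (fM.act (G.out tie v₀ fm fM n)).1.2.1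
      rw [payment_max] at h1
      linarith
  have hsum : Summable fun n : ℕ => a n ^ 2 := by
    have := (summable_nat_add_iff 1).2 (Real.summable_one_div_nat_pow.2 (le_refl 2))
    refine (this.mul_left (κ ^ 2)).congr fun n => ?_
    simp only [a]; push_cast; field_simp
  -- Beyond `N'`, the potential difference `2 * R` is at most `δ / 2 * n`.
  obtain ⟨N', hN'⟩ := exists_nat_ge (2 * (2 * R) / δ)
  refine not_forall_mul_le_sum_of_sum_div_le (x := x) (half_pos hδ) (N := max N N')
    (D := (-Real.log B + 2 * S ^ 2 * ∑' n, a n ^ 2) / κ) (fun n => ?_) fun n hn => ?_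
  · rw [le_div_iff₀ hκ, Finset.sum_mul]
    have h1 := hx2 n
    have h2 := hsum.sum_le_tsum (Finset.range n) fun i _ => sq_nonneg (a i)
    have h3 : ∑ i ∈ Finset.range n, x i / (i + 1) * κ = ∑ i ∈ Finset.range n, a i * x i :=
      Finset.sum_congr rfl fun i _ => by simp only [a]; ring
    rw [h3]
    refine h1.trans ?_
    gcongr
  · have h1 := hx1 n
    have h2 := hN n ((le_max_left _ _).trans hn)
    have h3 : (N' : ℝ) ≤ n := by exact_mod_cast (le_max_right _ _).trans hn
    have h4 := hN'.trans h3
    rw [div_le_iff₀ hδ] at h4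
    have h5 := (abs_le.1 (hR (some (G.out tie v₀ fm fM n).last))).1
    have h6 := (abs_le.1 (hR (some v₀))).2
    rw [energy, Int.cast_sum] at h2
    linarith

/-- Max wins with any positive budget if some vertex has a nonnegative Richman value after the
weights have been decreased. -/
theorem IsRealRichman.maxGuarantees {u : V} {F : Option V → ℝ} {ε : ℝ} (hε0 : 0 < ε) (hε1 : ε ≤ 1)
    (hF : G.IsRealRichman u (fun v => (G.w v : ℝ) - ε) F) (hu : 0 ≤ F (some u))
    (tie : TieBreaking V) {B : ℝ} (hB : 0 < B) (v₀ : V) : G.MaxGuarantees tie v₀ B := by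
  obtain ⟨s, best, hbest, hs0, hU, hUbest⟩ := hF.neg.exists_strength (by simpa using hu)
  obtain ⟨M, hM⟩ := exists_abs_le_of_finite s
  obtain ⟨R, hR⟩ := exists_abs_le_of_finite F
  have hM0 : 0 ≤ M := (abs_nonneg _).trans (hM v₀)
  set S : ℝ := M + 1 with hS
  have hS0 : 0 < S := by positivity
  have hsS : ∀ v, s v ≤ S := fun v => (le_abs_self _).trans ((hM v).trans (by linarith))
  -- With this choice the quadratic loss `2 * S ^ 2 * α` per round is `ε / 2`, half of the margin.
  let α : ℝ := ε / (4 * S ^ 2)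
  have hα : 0 < α := by positivity
  have hαS : α * S ≤ 1 / 2 := by
    have : α * S = ε / (4 * S) := by simp only [α]; field_simp
    rw [this, div_le_iff₀ (by positivity)]
    linarith
  have has : ∀ (n : ℕ) v, (fun _ : ℕ => α) n * s v ≤ 1 := fun n v =>
    (mul_le_mul_of_nonneg_left (hsS v) hα.le).trans (hαS.trans (by norm_num))
  refine ⟨fractionStrategy .max B (fun _ => α) s best hbest,
    legalMax_fractionStrategy tie has hB.le, fun fm hfm => ?_⟩
  set fM := fractionStrategy .max B (fun _ => α) s best hbest
  obtain ⟨x, hx1, hx2⟩ := exists_gains_of_follows (p := .max)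
    (c := fun v => -((G.w v : ℝ) - ε)) (U := fun v => -F (some v)) (hbest := hbest)
    (a := fun _ => α) (fun _ => hα.le) (fun _ => hαS) hs0 hsS hU hUbest hB
    (H := G.out tie v₀ fm fM) rfl (fun _ => (follows_next tie _ _ _).2) fun n => by
      have h1 := hfm v₀ fM n
      have h2 := (fm.act (G.out tie v₀ fm fM n)).1.2.1
      rw [payment_max]
      linarith
  refine meanPayoff_pos_of_le_energy (half_pos hε0) (D := 2 * R + -Real.log B / α) fun n => ?_
  have h1 := hx1 n
  have h2 := hx2 n
  have h5 := (abs_le.1 (hR (some (G.out tie v₀ fm fM n).last))).2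
  have h6 := (abs_le.1 (hR (some v₀))).1
  rw [← Finset.mul_sum] at h2
  simp only [Finset.sum_const, Finset.card_range, nsmul_eq_mul, Finset.sum_neg_distrib,
    Finset.sum_sub_distrib] at h1 h2
  have h3 : ∑ i ∈ Finset.range n, x i ≤ -Real.log B / α + ε / 2 * n := by
    have e1 : α * (-Real.log B / α + ε / 2 * n) = -Real.log B + 2 * S ^ 2 * (n * α ^ 2) := by
      have : ε = α * (4 * S ^ 2) := by simp only [α]; field_simp
      rw [this]
      field_simp
      ring
    rw [← e1] at h2
    exact le_of_mul_le_mul_left h2 hα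
  rw [energy, Int.cast_sum]
  linarith

end Guarantees

/-! ### Thresholds and the main theorem -/

theorem not_minGuarantees_and_maxGuarantees {tie : TieBreaking V} {v : V} {B : ℝ}
    (hm : G.MinGuarantees tie v B) (hM : G.MaxGuarantees tie v (1 - B)) : False := by
  obtain ⟨fm, hfm, h1⟩ := hm
  obtain ⟨fM, hfM, h2⟩ := hM
  exact (h2 fm (by rwa [sub_sub_cancel])).not_ge (h1 fM hfM)

/-- At `t = 0` Max's condition is vacuous, as no budget exceeds `1`. For `t > 0`, both players would
win when Min holds `t / 2`. -/
theorem isThreshold_iff_of_minGuarantees {tie : TieBreaking V} {v : V}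
    (h : ∀ B : ℝ, 0 < B → G.MinGuarantees tie v B) (t : ℝ) : G.IsThreshold tie v t ↔ t = 0 := by
  constructor
  · rintro ⟨⟨h0, h1⟩, -, hM⟩
    by_contra hne
    have ht : 0 < t := lt_of_le_of_ne h0 (Ne.symm hne)
    exact not_minGuarantees_and_maxGuarantees (h (t / 2) (half_pos ht))
      (hM (1 - t / 2) ⟨by linarith, by linarith⟩ (by linarith))
  · rintro rfl
    exact ⟨by simp, fun B _ hB => h B hB, fun B hB hB' => by linarith [hB.2]⟩

theorem isThreshold_iff_of_maxGuarantees {tie : TieBreaking V} {v : V}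
    (h : ∀ B : ℝ, 0 < B → G.MaxGuarantees tie v B) (t : ℝ) : G.IsThreshold tie v t ↔ t = 1 := by
  constructor
  · rintro ⟨⟨h0, h1⟩, hm, -⟩
    by_contra hne
    have ht : t < 1 := lt_of_le_of_ne h1 hne
    exact not_minGuarantees_and_maxGuarantees
      (hm ((1 + t) / 2) ⟨by linarith, by linarith⟩ (by linarith)) (h _ (by linarith))
  · rintro rfl
    exact ⟨by simp, fun B hB hB' => by linarith [hB.2], fun B _ hB => h B (by linarith)⟩

end MeanPayoffGame

/-- In a strongly connected mean-payoff bidding game, the threshold budgets of all vertices exist,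
are unique, and are the same `τ ∈ {0, 1}`; every vertex has a weighted Richman function; and `τ = 0`
iff some vertex `u` has a weighted Richman value `W u_s ≤ 0`. -/
theorem mainTheorem4 {V : Type*} [Finite V] (G : MeanPayoffGame V) (tie : TieBreaking V)
    (hG : G.StronglyConnected) :
    (∀ u : V, ∃ W : Option V → ℚ, G.IsWeightedRichman u W) ∧
    ∃ τ : ℝ, (τ = 0 ∨ τ = 1) ∧
      (∀ v : V, ∀ t : ℝ, G.IsThreshold tie v t ↔ t = τ) ∧
      (τ = 0 ↔ ∃ u : V, ∃ W : Option V → ℚ, G.IsWeightedRichman u W ∧ W (some u) ≤ 0) := by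
  refine ⟨fun u => ?_, ?_⟩
  · obtain ⟨W, hW⟩ := hG.exists_isRealRichman u fun v => (G.w v : ℝ)
    obtain ⟨W', hW', -⟩ := hW.exists_rat
    exact ⟨W', hW'⟩
  by_cases h : ∃ u : V, ∃ W : Option V → ℚ, G.IsWeightedRichman u W ∧ W (some u) ≤ 0
  · refine ⟨0, .inl rfl, fun v => MeanPayoffGame.isThreshold_iff_of_minGuarantees fun B hB => ?_,
      by simpa using h⟩
    obtain ⟨u, W, hW, hu⟩ := h
    exact hW.isRealRichman.minGuarantees (by exact_mod_cast hu) tie hB v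
  · refine ⟨1, .inr rfl, fun v => MeanPayoffGame.isThreshold_iff_of_maxGuarantees fun B hB => ?_,
      by simpa using h⟩
    -- If Max fails at `v`, every Richman function for weights lowered by `ε` is negative at `v`;
    -- letting `ε → 0` contradicts `h`.
    by_contra hM
    obtain ⟨W, hW, hu⟩ := hG.exists_isRealRichman_nonpos v (fun v => (G.w v : ℝ))
      fun ε hε0 hε1 F hF => by
        by_contra! hpos
        exact hM (hF.maxGuarantees hε0 hε1 hpos.le tie hB v)
    obtain ⟨W', hW', hle⟩ := hW.exists_rat
    exact h ⟨v, W', hW', hle hu⟩
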